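/- **Model.** Let $G=(V,E,p)$ be a finite directed graph with edge probabilities $p:E\to[0,1]$. In the comparative independent cascade model with reconsideration, two ideas $A,B$ spread from seed sets $S_A,S_B\subseteq V$. The parameters are probabilities $q_{A|\emptyset},q_{A|B},q_{B|\emptyset},q_{B|A}\in[0,1]$ and reconsideration probabilities $\rho_A,\rho_B\in[0,1]$ such that $$q_{A|\emptyset}+(1-q_{A|\emptyset})q_{B|\emptyset}\rho_A=(1-q_{B|\emptyset})q_{A|\emptyset}+q_{B|\emptyset}q_{A|B},$$ and symmetrically for $\rho_B$. Each edge $(x,y)$ is live with probability $p(x,y)$, independently. At time $0$ the seeds adopt their ideas and all else is idle (a seed of both ideas adopts them in random order). A vertex that adopts an idea proposes it in the next time step along its live out-edges. Proposals reaching a vertex at the same time are handled in the order of a random ordering of its in-edges; a vertex that adopted two ideas in one step proposes them in the order of adoption. When a proposal of $X\in\{A,B\}$ reaches an $X$-idle vertex, with $Y$ the other idea: if the vertex has adopted $Y$, it adopts $X$ with probability $q_{X|Y}$ and otherwise rejects $X$; if not, it adopts $X$ with probability $q_{X|\emptyset}$ and otherwise becomes $X$-suspended. A $Y$-suspended vertex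 that adopts $X$ at once reconsiders $Y$: it adopts $Y$ with probability $\rho_Y$ and otherwise rejects it. Let $\sigma_A^y(S_A,S_B)$ be the probability that $y$ adopts $A$ and $\sigma_A(S_A,S_B)=\sum_{y\in V}\sigma_A^y(S_A,S_B)$. A function $f:2^V\to\mathbb R$ is submodular if $f(S)+f(S\cup\{a,b\})\le f(S\cup\{a\})+f(S\cup\{b\})$ for all $S\subseteq V$ and $a,b\in V$. **Theorem.** Suppose that the ideas are complementary: $q_{A|\emptyset}\le q_{A|B}$ and $q_{B|\emptyset}\le q_{B|A}$. (1) If $q_{A|\emptyset}=q_{A|B}$, or $q_{B|\emptyset}=q_{B|A}$, or $q_{B|\emptyset}=0$, then for every network $G$ and every fixed $S_B$, the function $S_A\mapsto\sigma_A(S_A,S_B)$ is submodular. (2) There are a directed path $G$ with all edge probabilities $1$, seed sets $S_A,S_B$, and vertices $u,v,t$ of $G$ with $t\notin S_A\cup S_B\cup\{u,v\}$, such that for all parameters for which none of the three conditions holds, $$\sigma_A^t(S_A,S_B)+\sigma_A^t(S_A\cup\{u,v\},S_B)>\sigma_A^t(S_A\cup\{u\},S_B)+\sigma_A^t(S_A\cup\{v\},S_B),$$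 and moreover, for all sufficiently large $m$ (depending on the parameters), on the network obtained from $G$ by adding $m$ duplicates of $t$ (with the same in- and out-neighbours), $$\sigma_A(S_A,S_B)+\sigma_A(S_A\cup\{u,v\},S_B)>\sigma_A(S_A\cup\{u\},S_B)+\sigma_A(S_A\cup\{v\},S_B).$$ Consequently, $\sigma_A$ is submodular in $S_A$ on all networks if and only if one of the three conditions holds. -/

import Mathlib

open MeasureTheory

noncomputable section

/-! ### Submodular set functions -/

/-- A real set function `f` on the subsets of a finite ground set is submodular if
`f(S) + f(S ∪ {a, b}) ≤ f(S ∪ {a}) + f(S ∪ {b})` for all `S`, `a`, `b`. -/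
def IsSubmodular {V : Type*} [DecidableEq V] (f : Finset V → ℝ) : Prop :=
  ∀ (S : Finset V) (a b : V), f S + f (S ∪ {a, b}) ≤ f (S ∪ {a}) + f (S ∪ {b})

namespace ComIC

/-! ### The comparative independent cascade model with reconsideration -/

/-- The two ideas. -/
inductive Idea where
  | A
  | B
  deriving DecidableEq

instance : Fintype Idea where
  elems := {.A, .B}
  complete X := by cases X <;> decide

/-- The idea different from the given one. -/
def Idea.other : Idea → Idea
  | .A => .B
  | .B => .A

/-- The attitude of a vertex towards one idea. -/
inductive Status where
  | idle
  | suspended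
  | adopted
  | rejected
  deriving DecidableEq

/-- The parameters of the model: the global adoption probabilities
`q0 X = q_{X|∅}` and `q1 X = q_{X|Y}` (`Y` the other idea), and the reconsideration
probabilities `rho X = ρ_X`. -/
structure Params where
  q0 : Idea → ℝ
  q1 : Idea → ℝ
  rho : Idea → ℝ

/-- All parameters are probabilities. -/
def Params.AreProbabilities (P : Params) : Prop :=
  ∀ X : Idea, P.q0 X ∈ Set.Icc (0 : ℝ) 1 ∧ P.q1 X ∈ Set.Icc (0 : ℝ) 1 ∧
    P.rho X ∈ Set.Icc (0 : ℝ) 1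

/-- The ideas are mutually complementary: `q_{A|∅} ≤ q_{A|B}` and `q_{B|∅} ≤ q_{B|A}`. -/
def Params.Complementary (P : Params) : Prop :=
  ∀ X : Idea, P.q0 X ≤ P.q1 X

/-- The requirement of the model that links the reconsideration probabilities to the adoption
probabilities: for each idea `X`, with `Y` the other idea,
`q_{X|∅} + (1 - q_{X|∅}) q_{Y|∅} ρ_X = (1 - q_{Y|∅}) q_{X|∅} + q_{Y|∅} q_{X|Y}`. -/
def Params.Balanced (P : Params) : Prop :=
  ∀ X : Idea, P.q0 X + (1 - P.q0 X) * P.q0 X.other * P.rho X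
    = (1 - P.q0 X.other) * P.q0 X + P.q0 X.other * P.q1 X

/-- A social network: a directed graph with a probability on each edge.
The value of `p` at a pair that is not an edge is irrelevant. -/
structure Network (V : Type*) where
  graph : Digraph V
  p : V → V → unitInterval

/-- The state of a vertex: its attitude towards each idea, together with the ideas it has adopted
in the current time step, in the order of their adoption. -/
structure NodeState where
  status : Idea → Status
  fresh : List Idea

open Classical in
/-- A proposal of the idea `X` reaches a vertex in state `s` whose thresholds are `θ`; here
`θ A`, `θ B` are independent and uniform on `[0, 1]`.

Only an `X`-idle vertex reacts. If it has adopted the other idea `Y`, then it adopts `X` with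
probability `q_{X|Y}` and otherwise rejects it. If it has not adopted `Y`, then it adopts `X` with
probability `q_{X|∅}` and otherwise becomes `X`-suspended; if it adopts `X` and is `Y`-suspended,
then it at once reconsiders `Y`, adopting it with probability `ρ_Y` and otherwise rejecting it.

In any run a vertex examines an idea at most once, comparing its threshold with `q_{X|Y}` or
`q_{X|∅}`. A vertex that reconsiders `Y` has `θ Y ≥ q_{Y|∅}`, and given this,
`θ Y < q_{Y|∅} + (1 - q_{Y|∅}) ρ_Y` has probability `ρ_Y`. -/
def receive (P : Params) (θ : Idea → unitInterval) (s : NodeState) (X : Idea) : NodeState :=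
  if s.status X = .idle then
    if s.status X.other = .adopted then
      if (θ X : ℝ) < P.q1 X then
        ⟨Function.update s.status X .adopted, s.fresh ++ [X]⟩
      else
        ⟨Function.update s.status X .rejected, s.fresh⟩
    else
      if (θ X : ℝ) < P.q0 X then
        if s.status X.other = .suspended then
          if (θ X.other : ℝ) < P.q0 X.other + (1 - P.q0 X.other) * P.rho X.other then
            ⟨Function.update (Function.update s.status X .adopted) X.other .adopted,
              s.fresh ++ [X, X.other]⟩
          else
            ⟨Function.update (Function.update s.status X .adopted) X.other .rejected,
              s.fresh ++ [X]⟩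
        else
          ⟨Function.update s.status X .adopted, s.fresh ++ [X]⟩
      else
        ⟨Function.update s.status X .suspended, s.fresh⟩
  else s

section Cascade

variable {V : Type*} [Fintype V] [DecidableEq V]

/-- The tie-breaking data: for every vertex an ordering of the vertices (only the ordering that it
induces on the in-neighbours matters), and for every vertex a coin that decides, should the vertex
be a seed of both ideas, whether it adopts `A` first. -/
abbrev Ties (V : Type*) [Fintype V] : Type _ :=
  (V → Fin (Fintype.card V) ≃ V) × (V → Bool)

/-- The numbers drawn uniformly from `[0, 1]`: one for each ordered pair of vertices, to
decide whether an edge is live, and one for each vertex and each idea. -/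
abbrev Draws (V : Type*) : Type _ :=
  (V → V → unitInterval) × (V → Idea → unitInterval)

/-- The edge from `x` to `y` exists and is live, which has probability `p x y`. The same coin of
the edge serves both ideas. -/
def Live (N : Network V) (ω : Draws V) (x y : V) : Prop :=
  N.graph.Adj x y ∧ ω.1 x y ≤ N.p x y

/-- The states at time `0`: the seeds have just adopted their ideas, everything else is idle. -/
def initial (SA SB : Finset V) (τ : Ties V) (y : V) : NodeState where
  status
    | .A => if y ∈ SA then .adopted else .idle
    | .B => if y ∈ SB then .adopted else .idle
  fresh :=
    if y ∈ SA then
      if y ∈ SB then (if τ.2 y then [.A, .B] else [.B, .A]) else [.A]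
    else
      if y ∈ SB then [.B] else []

open Classical in
/-- The proposals that reach the vertex `y` in the next time step, in the order in which they are
considered: the live in-neighbours are taken in the order drawn for `y`, and each of them
proposes the ideas that it adopted in the current step, in the order in which it adopted them. -/
def proposals (N : Network V) (τ : Ties V) (ω : Draws V) (s : V → NodeState) (y : V) :
    List Idea :=
  ((List.ofFn (τ.1 y)).filter (fun x => decide (Live N ω x y))).flatMap (fun x => (s x).fresh)

/-- One time step of the cascade. -/
def step (N : Network V) (P : Params) (τ : Ties V) (ω : Draws V) (s : V → NodeState) :
    V → NodeState :=
  fun y => (proposals N τ ω s y).foldl (receive P (ω.2 y)) ⟨(s y).status, []⟩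

/-- The states at time `k`, for seed sets `SA` of `A` and `SB` of `B`. -/
def stateAt (N : Network V) (P : Params) (SA SB : Finset V) (τ : Ties V) (ω : Draws V) (k : ℕ) :
    V → NodeState :=
  (step N P τ ω)^[k] (initial SA SB τ)

/-- At the end of the cascade the vertex `y` has adopted `A`. -/
def AdoptsA (N : Network V) (P : Params) (SA SB : Finset V) (τ : Ties V) (ω : Draws V) (y : V) :
    Prop :=
  ∃ k : ℕ, (stateAt N P SA SB τ ω k y).status .A = .adopted

/-- Expectation over all randomness: the draws are independent and uniform on `[0, 1]`, and the
tie-breaking data are independent of them and uniform on a finite set. -/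
def expectation (f : Ties V → Draws V → ℝ) : ℝ :=
  (∑ τ : Ties V, ∫ ω : Draws V, f τ ω) / (Fintype.card (Ties V) : ℝ)

open Classical in
/-- `σ_A^y(S_A, S_B)`: the probability that the vertex `y` adopts `A`. -/
def sigmaAt (N : Network V) (P : Params) (SA SB : Finset V) (y : V) : ℝ :=
  expectation fun τ ω => if AdoptsA N P SA SB τ ω y then 1 else 0

open Classical in
/-- `σ_A(S_A, S_B)`: the expected number of vertices that adopt `A`. -/
def sigma (N : Network V) (P : Params) (SA SB : Finset V) : ℝ :=
  expectation fun τ ω => ((Finset.univ.filter fun y => AdoptsA N P SA SB τ ω y).card : ℝ)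

end Cascade

/-! ### The networks of the counterexample -/

/-- The directed path `0 → 1 → ⋯ → n - 1`, with probability `1` on each edge. -/
def pathNetwork (n : ℕ) : Network (Fin n) where
  graph := { Adj := fun i j => (i : ℕ) + 1 = j }
  p := fun _ _ => 1

/-- The network in which the vertex `t` has been given `m` additional duplicates `Sum.inr i`, which
have the same in- and out-neighbours and edge probabilities as `t`. -/
def Network.duplicate {V : Type*} (N : Network V) (t : V) (m : ℕ) : Network (V ⊕ Fin m) where
  graph := { Adj := fun x y =>
    N.graph.Adj (Sum.elim id (fun _ => t) x) (Sum.elim id (fun _ => t) y) }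
  p := fun x y => N.p (Sum.elim id (fun _ => t) x) (Sum.elim id (fun _ => t) y)

end ComIC

end

noncomputable section

namespace ComIC

/-! Fix all the randomness (orderings, coins and draws), so that the cascade is deterministic.

Under each of the three conditions there is a set `g` of vertices, not depending on the seeds of A,
such that the adopters of A are the vertices reachable from these seeds along live edges through `g`
(`exists_adoptsA_iff_reach`). If A is indifferent to B, balance makes reconsideration of A
ineffective, and `g` is given by θ_A < q_{A|∅}. If B is indifferent to A and q_{B|∅} ≠ 0, then B
spreads on its own, and balance makes the order in which A and B arrive irrelevant for A. If q_{B|∅}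
= 0, a vertex that is not a seed of B takes B only after A, so B helps A only at the seeds of B.
Reachability from a union is the union of the reachabilities, so each indicator of adoption is
submodular, and averaging preserves this (`isSubmodular_sigma`).

For the converse, B starts at vertex 0 of the path 0 → ⋯ → 5 and helps t = 5 to adopt A only if it
passes 1, 2, 3 and 4. Seeding A at u = 1 or v = 3 raises the threshold of that vertex for B to
q_{B|A}. The permanent A-seeds 2 and 4 always emit A before B, so the choice at 1 affects later
vertices only through the passage of B, and likewise the choice at 3. Hence adoption at 5 has the
form p ∨ (u ∧ v ∧ q), where u depends only on the choice at 1 and v only on that at 3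
(`adoptsA_iff_of_isPath`). A conjunction is supermodular, strictly so on the event `violation`,
whose probability `gap` is positive exactly because the three conditions fail (`gap_pos`).
Duplicates of 5 repeat this gain until it outweighs any loss at the six path vertices. -/

@[simp] lemma Idea.other_A : Idea.A.other = .B := rfl

@[simp] lemma Idea.other_B : Idea.B.other = .A := rfl

/-- A vertex that is `X`-suspended and adopts the other idea adopts `X` if its threshold for `X` is
below this value. -/
def Params.reconsider (P : Params) (X : Idea) : ℝ := P.q0 X + (1 - P.q0 X) * P.rho X

/-! ### Receiving a proposal -/

section Receive

variable {P : Params} {θ : Idea → unitInterval} {s : NodeState} {X Z : Idea}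

/-- Reconsideration only touches a suspended idea, so only a proposal of an idea itself ends
idleness towards it. Thus non-idle means: seed, or reached by a proposal. -/
lemma receive_status_ne_idle_iff :
    (receive P θ s X).status Z ≠ .idle ↔ Z = X ∨ s.status Z ≠ .idle := by
  unfold receive
  cases X <;> cases Z <;> split_ifs <;> simp_all [Function.update]

lemma receive_adopted (h : s.status Z = .adopted) :
    (receive P θ s X).status Z = .adopted := by
  unfold receive
  cases X <;> cases Z <;> split_ifs <;> simp_all [Function.update]

lemma adopted_of_mem_receive_fresh (h : ∀ Z ∈ s.fresh, s.status Z = .adopted) :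
    ∀ Z ∈ (receive P θ s X).fresh, (receive P θ s X).status Z = .adopted := by
  intro Z hZ
  have := h Z
  unfold receive at hZ ⊢
  cases X <;> cases Z <;> split_ifs at hZ ⊢ <;> simp_all [Function.update]

lemma mem_receive_fresh {q : Prop} (h : s.status Z = .adopted → q ∨ Z ∈ s.fresh) :
    (receive P θ s X).status Z = .adopted → q ∨ Z ∈ (receive P θ s X).fresh := by
  unfold receive
  cases X <;> cases Z <;> split_ifs <;> simp_all [Function.update]

lemma foldl_receive_induction {p : NodeState → Prop}
    (h : ∀ s X, p s → p (receive P θ s X)) (hs : p s) (l : List Idea) :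
    p (l.foldl (receive P θ) s) := by
  induction l generalizing s with
  | nil => exact hs
  | cons X l ih => exact ih (h _ _ hs)

lemma foldl_receive_status_ne_idle_iff {l : List Idea} :
    (l.foldl (receive P θ) s).status Z ≠ .idle ↔ Z ∈ l ∨ s.status Z ≠ .idle := by
  induction l generalizing s with
  | nil => simp
  | cons X l ih =>
    rw [List.foldl_cons, ih, receive_status_ne_idle_iff, List.mem_cons]
    tauto

/-- What the status of a vertex towards the idea `X` says about its thresholds and about its
status towards the other idea. -/
structure Explained (P : Params) (θ : Idea → unitInterval) (seed : Idea → Prop)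
    (st : Idea → Status) (X : Idea) : Prop where
  suspended : st X = .suspended → ¬ (θ X : ℝ) < P.q0 X ∧ st X.other ≠ .adopted
  rejected : st X = .rejected → st X.other = .adopted ∧
    (¬ (θ X : ℝ) < P.q1 X ∨ (¬ (θ X : ℝ) < P.q0 X ∧ ¬ (θ X : ℝ) < P.reconsider X ∧
      (θ X.other : ℝ) < P.q0 X.other))
  adopted : st X = .adopted → seed X ∨ (θ X : ℝ) < P.q0 X ∨
    ((θ X : ℝ) < P.q1 X ∧ st X.other = .adopted) ∨
    (¬ (θ X : ℝ) < P.q0 X ∧ (θ X : ℝ) < P.reconsider X ∧ st X.other = .adopted ∧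
      (θ X.other : ℝ) < P.q0 X.other)

/-- The invariant is carried for both ideas at once, because a reconsideration changes both statuses
in one move. -/
lemma Explained.receive {seed : Idea → Prop}
    (h : ∀ Z, Explained P θ seed s.status Z) (Z : Idea) :
    Explained P θ seed (receive P θ s X).status Z := by
  obtain ⟨hA1, hA2, hA3⟩ := h .A
  obtain ⟨hB1, hB2, hB3⟩ := h .B
  simp only [Params.reconsider, Idea.other_A, Idea.other_B] at *
  unfold ComIC.receive
  clear h
  cases X <;> cases Z <;> split_ifs <;> constructor <;>
    simp only [Function.update, Params.reconsider, Idea.other_A, Idea.other_B] at * <;> grind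

/-- If `Y` is never adopted by a vertex that has not adopted `X`, then a vertex that is not a seed
of `Y` does not adopt `Y` before `X`. -/
lemma receive_adopted_of_q0_eq_zero {seed : Prop} (hq : P.q0 .B = 0)
    (h : (s.status .B = .adopted → s.status .A = .adopted) ∧
      (s.status .A = .adopted → seed ∨ (θ .A : ℝ) < P.q0 .A)) :
    ((receive P θ s X).status .B = .adopted → (receive P θ s X).status .A = .adopted) ∧
      ((receive P θ s X).status .A = .adopted → seed ∨ (θ .A : ℝ) < P.q0 .A) := by
  have h0 := (θ .B).2.1
  unfold receive
  cases X <;> split_ifs <;> simp_all [Function.update] <;> first | tauto | linarith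

end Receive

section Cascade

variable {V : Type*} [Fintype V] [DecidableEq V] {N : Network V} {P : Params}
  {SA SB : Finset V} {τ : Ties V} {ω : Draws V}

/-! ### The course of a cascade -/

lemma stateAt_succ (k : ℕ) :
    stateAt N P SA SB τ ω (k + 1) = step N P τ ω (stateAt N P SA SB τ ω k) :=
  Function.iterate_succ_apply' _ _ _

omit [DecidableEq V] in
lemma mem_proposals {s : V → NodeState} {y : V} {X : Idea} :
    X ∈ proposals N τ ω s y ↔ ∃ x, Live N ω x y ∧ X ∈ (s x).fresh := by
  simp only [proposals, List.mem_flatMap, List.mem_filter, decide_eq_true_eq, List.mem_ofFn]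
  constructor
  · rintro ⟨x, ⟨-, h⟩, hX⟩
    exact ⟨x, h, hX⟩
  · rintro ⟨x, h, hX⟩
    exact ⟨x, ⟨⟨(τ.1 y).symm x, by simp⟩, h⟩, hX⟩

lemma status_induction {y : V} {p : (Idea → Status) → Prop}
    (h0 : p (initial SA SB τ y).status)
    (h : ∀ s X, p s.status → p (receive P (ω.2 y) s X).status) (k : ℕ) :
    p (stateAt N P SA SB τ ω k y).status := by
  induction k with
  | zero => exact h0
  | succ k ih =>
    rw [stateAt_succ]
    exact foldl_receive_induction (p := fun s => p s.status)
      (s := ⟨(stateAt N P SA SB τ ω k y).status, []⟩) h ih _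

lemma adopted_mono {y : V} {X : Idea} {j k : ℕ} (hjk : j ≤ k)
    (h : (stateAt N P SA SB τ ω j y).status X = .adopted) :
    (stateAt N P SA SB τ ω k y).status X = .adopted := by
  induction k, hjk using Nat.le_induction with
  | base => exact h
  | succ k _ ih =>
    rw [stateAt_succ]
    exact foldl_receive_induction (p := fun s => s.status X = .adopted)
      (s := ⟨(stateAt N P SA SB τ ω k y).status, []⟩) (fun _ _ => receive_adopted) ih _

lemma status_ne_idle_mono {y : V} {X : Idea} {j k : ℕ} (hjk : j ≤ k)
    (h : (stateAt N P SA SB τ ω j y).status X ≠ .idle) :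
    (stateAt N P SA SB τ ω k y).status X ≠ .idle := by
  induction k, hjk using Nat.le_induction with
  | base => exact h
  | succ k _ ih =>
    rw [stateAt_succ]
    exact foldl_receive_status_ne_idle_iff.2 (.inr ih)

/-- The seeds of an idea. -/
def seeds (SA SB : Finset V) : Idea → Finset V
  | .A => SA
  | .B => SB

lemma initial_status {y : V} {X : Idea} :
    (initial SA SB τ y).status X = if y ∈ seeds SA SB X then .adopted else .idle := by
  cases X <;> rfl

lemma mem_initial_fresh {y : V} {X : Idea} :
    X ∈ (initial SA SB τ y).fresh ↔ y ∈ seeds SA SB X := by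
  cases X <;> simp only [initial, seeds] <;> split_ifs <;> simp_all

lemma adopted_of_mem_fresh {y : V} {X : Idea} {k : ℕ}
    (h : X ∈ (stateAt N P SA SB τ ω k y).fresh) :
    (stateAt N P SA SB τ ω k y).status X = .adopted := by
  cases k with
  | zero =>
    have := mem_initial_fresh.1 h
    exact initial_status.trans (if_pos this)
  | succ k =>
    rw [stateAt_succ] at h ⊢
    exact foldl_receive_induction (p := fun s => ∀ Z ∈ s.fresh, s.status Z = .adopted)
      (fun _ _ => adopted_of_mem_receive_fresh) (by simp) _ X h

lemma exists_mem_fresh {y : V} {X : Idea} {k : ℕ}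
    (h : (stateAt N P SA SB τ ω k y).status X = .adopted) :
    ∃ j, X ∈ (stateAt N P SA SB τ ω j y).fresh := by
  induction k with
  | zero =>
    refine ⟨0, mem_initial_fresh.2 ?_⟩
    by_contra hy
    have := initial_status (SA := SA) (SB := SB) (τ := τ) (y := y) (X := X)
    rw [if_neg hy] at this
    exact absurd (h.symm.trans this) (by simp)
  | succ k ih =>
    by_cases hk : (stateAt N P SA SB τ ω k y).status X = .adopted
    · exact ih hk
    refine ⟨k + 1, ?_⟩
    rw [stateAt_succ] at h ⊢
    exact (foldl_receive_induction (p := fun s => s.status X = .adopted → False ∨ X ∈ s.fresh)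
      (s := ⟨(stateAt N P SA SB τ ω k y).status, []⟩) (fun _ _ => mem_receive_fresh) (fun h' => absurd h' hk) _ h).resolve_left id

lemma status_succ_ne_idle_iff {y : V} {X : Idea} {k : ℕ} :
    (stateAt N P SA SB τ ω (k + 1) y).status X ≠ .idle ↔
      (∃ x, Live N ω x y ∧ X ∈ (stateAt N P SA SB τ ω k x).fresh) ∨
        (stateAt N P SA SB τ ω k y).status X ≠ .idle := by
  rw [stateAt_succ, ← mem_proposals (τ := τ)]
  exact foldl_receive_status_ne_idle_iff

lemma explained (y : V) (k : ℕ) (X : Idea) :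
    Explained P (ω.2 y) (fun X => y ∈ seeds SA SB X) (stateAt N P SA SB τ ω k y).status X := by
  refine status_induction (p := fun st => ∀ X,
    Explained P (ω.2 y) (fun X => y ∈ seeds SA SB X) st X) (fun X => ?_)
    (fun s X h Z => Explained.receive h Z) k X
  constructor <;> rw [initial_status] <;> split_ifs <;> simp_all

/-! ### Spread by reachability -/

/-- The vertices reachable from `S` along live edges through vertices in `g`. -/
inductive Reach (N : Network V) (ω : Draws V) (g : V → Prop) (S : Finset V) : V → Prop
  | seed {y : V} : y ∈ S → Reach N ω g S y
  | step {x y : V} : Reach N ω g S x → Live N ω x y → g y → Reach N ω g S y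

omit [Fintype V] [DecidableEq V] in
lemma Reach.mono {g : V → Prop} {S T : Finset V} (hST : S ⊆ T) {y : V} (h : Reach N ω g S y) :
    Reach N ω g T y := by
  induction h with
  | seed h => exact .seed (hST h)
  | step _ hl hg ih => exact .step ih hl hg

-- A live path starts at a single seed; this additivity is the source of submodularity.
omit [Fintype V] in
lemma reach_union {g : V → Prop} {S T : Finset V} {y : V} :
    Reach N ω g (S ∪ T) y ↔ Reach N ω g S y ∨ Reach N ω g T y := by
  constructor
  · intro h
    induction h with
    | seed h => exact (Finset.mem_union.1 h).imp .seed .seed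
    | step _ hl hg ih => exact ih.imp (.step · hl hg) (.step · hl hg)
  · rintro (h | h)
    · exact h.mono Finset.subset_union_left
    · exact h.mono Finset.subset_union_right

/-- Common frame for the three conditions: `g` must contain every adopter that is not a seed, and
every vertex of `g` that hears of `X` must adopt it sooner or later. -/
lemma exists_adopted_iff_reach {X : Idea} {g : V → Prop}
    (hsound : ∀ k y, (stateAt N P SA SB τ ω k y).status X = .adopted →
      y ∈ seeds SA SB X ∨ g y)
    (hcomplete : ∀ k y, g y → (stateAt N P SA SB τ ω k y).status X ≠ .idle →
      ∃ j, (stateAt N P SA SB τ ω j y).status X = .adopted) (y : V) :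
    (∃ k, (stateAt N P SA SB τ ω k y).status X = .adopted) ↔
      Reach N ω g (seeds SA SB X) y := by
  constructor
  -- The induction on time runs over non-idle vertices, since a vertex may be suspended first and
  -- adopt later without a new proposal of `X`.
  · have reach_of {k : ℕ} (h : ∀ y, (stateAt N P SA SB τ ω k y).status X ≠ .idle →
        y ∈ seeds SA SB X ∨ ∃ x, Reach N ω g (seeds SA SB X) x ∧ Live N ω x y) (y : V)
        (hy : (stateAt N P SA SB τ ω k y).status X = .adopted) :
        Reach N ω g (seeds SA SB X) y := by
      rcases h y (by simp [hy]) with h | ⟨x, hx, hl⟩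
      · exact .seed h
      · exact (hsound k y hy).elim .seed (.step hx hl)
    rintro ⟨k, hk⟩
    refine reach_of (k := k) ?_ y hk
    clear hk y
    induction k with
    | zero =>
      intro y hy
      left
      by_contra h
      exact hy (initial_status.trans (if_neg h))
    | succ k ih =>
      intro y hy
      rcases status_succ_ne_idle_iff.1 hy with ⟨x, hl, hx⟩ | h
      · exact .inr ⟨x, reach_of ih x (adopted_of_mem_fresh hx), hl⟩
      · exact ih y h
  · intro h
    induction h with
    | seed h => exact ⟨0, initial_status.trans (if_pos h)⟩
    | step _ hl hg ih =>
      obtain ⟨k, hk⟩ := ih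
      obtain ⟨j, hj⟩ := exists_mem_fresh hk
      exact hcomplete (j + 1) _ hg (status_succ_ne_idle_iff.2 (.inl ⟨_, hl, hj⟩))

/-! ### The three conditions -/

/-- An idea that is indifferent to the other one spreads on its own. -/
lemma exists_adopted_iff_reach_of_q0_eq_q1 (hP : P.Balanced) {X : Idea}
    (hX : P.q0 X = P.q1 X) (y : V) :
    (∃ k, (stateAt N P SA SB τ ω k y).status X = .adopted) ↔
      Reach N ω (fun y => (ω.2 y X : ℝ) < P.q0 X) (seeds SA SB X) y := by
  have key (y : V) : ¬ (¬ (ω.2 y X : ℝ) < P.q0 X ∧ (ω.2 y X : ℝ) < P.reconsider X ∧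
      (ω.2 y X.other : ℝ) < P.q0 X.other) := by
    rintro ⟨h1, h2, h3⟩
    -- Balance kills this product. A nonnegative threshold below `P.q0 X.other` makes the first
    -- factor nonzero, so the second vanishes and reconsidering adds nothing.
    have h4 : P.q0 X.other * ((1 - P.q0 X) * P.rho X) = 0 := by
      have := hP X
      rw [← hX] at this
      linarith
    have h5 := (ω.2 y X.other).2.1
    have h6 : (1 - P.q0 X) * P.rho X = 0 :=
      (mul_eq_zero.1 h4).resolve_left (by intro h; rw [h] at h3; linarith)
    rw [Params.reconsider, h6] at h2
    exact h1 (by linarith)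
  refine exists_adopted_iff_reach (fun k y h => ?_) (fun k y hg h => ⟨k, ?_⟩) y
  · have := (explained y k X).adopted h
    have := key y
    rw [← hX] at *
    tauto
  · have hs := (explained (N := N) (P := P) (SA := SA) (SB := SB) (τ := τ) (ω := ω) y k X).suspended
    have hr := (explained (N := N) (P := P) (SA := SA) (SB := SB) (τ := τ) (ω := ω) y k X).rejected
    rw [← hX] at hr
    cases hst : (stateAt N P SA SB τ ω k y).status X <;> tauto

/-- Seeds of B hold B from time 0, so they always judge A with q_{A|B}. Any other vertex can take B
only after A, so it judges A with q_{A|∅} and a suspension of A is final. -/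
lemma adoptsA_iff_reach_of_q0_other_eq_zero (hC : P.Complementary) (hB : P.q0 .B = 0) (y : V) :
    AdoptsA N P SA SB τ ω y ↔
      Reach N ω (fun y => y ∈ SB ∧ (ω.2 y .A : ℝ) < P.q1 .A ∨ y ∉ SB ∧ (ω.2 y .A : ℝ) < P.q0 .A)
        SA y := by
  have hle := hC .A
  have hθ (y : V) : ¬ (ω.2 y .B : ℝ) < P.q0 .B := by
    rw [hB]
    exact not_lt.2 (ω.2 y .B).2.1
  have hseed (y : V) (k : ℕ) (h : y ∈ SB) : (stateAt N P SA SB τ ω k y).status .B = .adopted :=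
    adopted_mono (Nat.zero_le k) (if_pos h)
  have hnot (y : V) (k : ℕ) (h : y ∉ SB) := status_induction (N := N) (P := P) (SA := SA) (SB := SB)
    (τ := τ) (ω := ω) (y := y) (p := fun st => (st .B = .adopted → st .A = .adopted) ∧
      (st .A = .adopted → y ∈ SA ∨ (ω.2 y .A : ℝ) < P.q0 .A))
    (by
      have hB : y ∉ seeds SA SB .B := h
      rw [initial_status, initial_status, if_neg hB, seeds]
      by_cases hA : y ∈ SA <;> simp [hA])
    (fun s X => receive_adopted_of_q0_eq_zero hB) k
  refine exists_adopted_iff_reach (X := .A) (fun k y h => ?_) (fun k y hg h => ⟨k, ?_⟩) y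
  · have h1 := (explained y k .A).adopted h
    have h2 := hseed y k
    have h3 := hnot y k
    have h4 := hθ y
    simp only [Idea.other_A, seeds] at *
    by_cases hy : y ∈ SB
    · rcases h1 with h1 | h1 | h1 | h1
      · exact .inl h1
      · exact .inr (.inl ⟨hy, h1.trans_le hle⟩)
      · exact .inr (.inl ⟨hy, h1.1⟩)
      · tauto
    · tauto
  · have hs := (explained (N := N) (P := P) (SA := SA) (SB := SB) (τ := τ) (ω := ω) y k .A).suspended
    have hr := (explained (N := N) (P := P) (SA := SA) (SB := SB) (τ := τ) (ω := ω) y k .A).rejected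
    have h2 := hseed y k
    have h3 := hnot y k
    have h4 := hθ y
    have h5 := fun h : (ω.2 y .A : ℝ) < P.q0 .A => h.trans_le hle
    simp only [Idea.other_A] at *
    cases hst : (stateAt N P SA SB τ ω k y).status .A <;> simp only [hst] at * <;> tauto

/-- Cancelling q_{B|∅} in the balance equation turns the reconsideration threshold of A into
q_{A|B}, so it does not matter whether A or B arrives first. Which vertices B reaches does not
depend on the seeds of A. -/
lemma adoptsA_iff_reach_of_q0_eq_q1_other (hC : P.Complementary) (hP : P.Balanced)
    (hB : P.q0 .B = P.q1 .B) (h0 : P.q0 .B ≠ 0) (y : V) :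
    AdoptsA N P SA SB τ ω y ↔
      Reach N ω (fun y => (ω.2 y .A : ℝ) < P.q0 .A ∨
        (Reach N ω (fun y => (ω.2 y .B : ℝ) < P.q0 .B) SB y ∧ (ω.2 y .A : ℝ) < P.q1 .A)) SA y := by
  have hle := hC .A
  have hr : P.reconsider .A = P.q1 .A := by
    have := hP .A
    refine mul_left_cancel₀ h0 ?_
    simp only [Params.reconsider, Idea.other_A] at *
    linarith
  have hBr (y : V) := exists_adopted_iff_reach_of_q0_eq_q1 (N := N) (SA := SA) (SB := SB) (τ := τ)
    (ω := ω) hP (X := .B) hB y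
  simp only [seeds] at hBr
  simp only [← hBr]
  refine exists_adopted_iff_reach (X := .A) (fun k y h => ?_) (fun k y hg h => ?_) y
  · have h1 := (explained y k .A).adopted h
    rw [hr] at h1
    simp only [Idea.other_A, seeds] at *
    rcases h1 with h1 | h1 | h1 | h1
    · exact .inl h1
    · exact .inr (.inl h1)
    · exact .inr (.inr ⟨⟨k, h1.2⟩, h1.1⟩)
    · exact .inr (.inr ⟨⟨k, h1.2.2.1⟩, h1.2.1⟩)
  · have hex (k : ℕ) := explained (N := N) (P := P) (SA := SA) (SB := SB) (τ := τ) (ω := ω) y k .A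
    rcases hg with hg | ⟨⟨j, hj⟩, hg⟩
    · refine ⟨k, ?_⟩
      have hs := (hex k).suspended
      have hrj := (hex k).rejected
      have hlt := hg.trans_le hle
      cases hst : (stateAt N P SA SB τ ω k y).status .A <;> tauto
    -- By this time the vertex has both heard of A and adopted B.
    · refine ⟨max j k, ?_⟩
      have hs := (hex (max j k)).suspended
      have hrj := (hex (max j k)).rejected
      have hi := status_ne_idle_mono (le_max_right j k) h
      have ha := adopted_mono (le_max_left j k) hj
      rw [hr] at hrj
      simp only [Idea.other_A] at *
      cases hst : (stateAt N P SA SB τ ω (max j k) y).status .A <;> tauto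

/-- Under any of the three conditions, the vertices that adopt `A` are those reachable from the
seeds of `A` in a graph that does not depend on these seeds. -/
lemma exists_adoptsA_iff_reach (hC : P.Complementary) (hP : P.Balanced)
    (h : P.q0 .A = P.q1 .A ∨ P.q0 .B = P.q1 .B ∨ P.q0 .B = 0) (SB : Finset V) (τ : Ties V)
    (ω : Draws V) :
    ∃ g : V → Prop, ∀ SA y, AdoptsA N P SA SB τ ω y ↔ Reach N ω g SA y := by
  -- Split off first, because the case of B indifferent to A cancels `P.q0 .B`.
  by_cases h0 : P.q0 .B = 0
  · exact ⟨_, fun SA y => adoptsA_iff_reach_of_q0_other_eq_zero hC h0 y⟩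
  rcases h with h | h | h
  · exact ⟨_, fun SA y => exists_adopted_iff_reach_of_q0_eq_q1 hP (X := .A) h y⟩
  · exact ⟨_, fun SA y => adoptsA_iff_reach_of_q0_eq_q1_other hC hP h h0 y⟩
  · exact absurd h h0

end Cascade

/-! ### Measurability, and passing from outcomes to probabilities -/

section Measurability

variable {V : Type*} [Fintype V] [DecidableEq V] (N : Network V) (P : Params)

/-- The outcomes of the finitely many comparisons of draws on which a cascade depends. -/
def comparisons (ω : Draws V) : (V → V → Prop) × (V → Idea → Prop × Prop × Prop) :=
  (fun x y => ω.1 x y ≤ N.p x y,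
    fun y X => ((ω.2 y X : ℝ) < P.q0 X, (ω.2 y X : ℝ) < P.q1 X, (ω.2 y X : ℝ) < P.reconsider X))

omit [Fintype V] [DecidableEq V] in
lemma measurable_comparisons : Measurable (comparisons N P) := by
  have h1 (x y : V) : Measurable fun ω : Draws V => ω.1 x y := by fun_prop
  have h2 (y : V) (X : Idea) : Measurable fun ω : Draws V => (ω.2 y X : ℝ) := by fun_prop
  refine Measurable.prodMk ?_ ?_
  · refine measurable_pi_lambda _ fun x => measurable_pi_lambda _ fun y => ?_
    exact measurableSet_setOfPred.1 (measurableSet_le (h1 x y) measurable_const)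
  · refine measurable_pi_lambda _ fun y => measurable_pi_lambda _ fun X => ?_
    exact (measurableSet_setOfPred.1 (measurableSet_lt (h2 y X) measurable_const)).prodMk
      ((measurableSet_setOfPred.1 (measurableSet_lt (h2 y X) measurable_const)).prodMk
        (measurableSet_setOfPred.1 (measurableSet_lt (h2 y X) measurable_const)))

variable {N P}

lemma receive_congr {θ θ' : Idea → unitInterval}
    (h : ∀ X, ((θ X : ℝ) < P.q0 X ↔ (θ' X : ℝ) < P.q0 X) ∧
      ((θ X : ℝ) < P.q1 X ↔ (θ' X : ℝ) < P.q1 X) ∧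
      ((θ X : ℝ) < P.reconsider X ↔ (θ' X : ℝ) < P.reconsider X)) :
    receive P θ = receive P θ' := by
  funext s X
  have h1 := (h X).1
  have h2 := (h X).2.1
  have h3 := (h X.other).2.2
  simp only [Params.reconsider] at h3
  simp only [receive, h1, h2, h3]

lemma adoptsA_congr {ω ω' : Draws V} (h : comparisons N P ω = comparisons N P ω')
    (SA SB : Finset V) (τ : Ties V) (y : V) :
    AdoptsA N P SA SB τ ω y ↔ AdoptsA N P SA SB τ ω' y := by
  have hL : Live N ω = Live N ω' := by
    funext x y
    have := congrFun (congrFun (congrArg Prod.fst h) x) y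
    simp only [comparisons] at this
    simp only [Live, this]
  have hR (y : V) : receive P (ω.2 y) = receive P (ω'.2 y) := by
    refine receive_congr fun X => ?_
    have := congrFun (congrFun (congrArg Prod.snd h) y) X
    simpa only [comparisons, Prod.mk.injEq, eq_iff_iff] using this
  have hS : step N P τ ω = step N P τ ω' := by
    funext s y
    simp only [step, proposals, hR]
    rw [hL]
  simp only [AdoptsA, stateAt, hS]

/-- The cascade depends on the draws only through `comparisons`, which takes values in a finite
type, so the event is the preimage of a finite set. -/
lemma measurableSet_adoptsA (SA SB : Finset V) (τ : Ties V) (y : V) :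
    MeasurableSet {ω | AdoptsA N P SA SB τ ω y} := by
  have h : {ω | AdoptsA N P SA SB τ ω y} =
      comparisons N P ⁻¹' (comparisons N P '' {ω | AdoptsA N P SA SB τ ω y}) := by
    refine (Set.subset_preimage_image _ _).antisymm ?_
    rintro ω ⟨ω', h', h⟩
    exact (adoptsA_congr h SA SB τ y).1 h'
  rw [h]
  exact measurable_comparisons N P (Set.Finite.measurableSet (Set.toFinite _))

open Classical in
lemma integrable_adoptsA (SA SB : Finset V) (τ : Ties V) (y : V) :
    Integrable (fun ω => if AdoptsA N P SA SB τ ω y then (1 : ℝ) else 0) := by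
  refine ((integrable_const (1 : ℝ)).indicator (measurableSet_adoptsA (N := N) (P := P) SA SB τ y)).congr ?_
  exact .of_forall fun ω => by simp [Set.indicator_apply]

lemma sigma_eq_sum_sigmaAt (SA SB : Finset V) :
    sigma N P SA SB = ∑ y, sigmaAt N P SA SB y := by
  classical
  simp only [sigma, sigmaAt, expectation, ← Finset.sum_div]
  rw [Finset.sum_comm]
  congr 1
  refine Finset.sum_congr rfl fun τ _ => ?_
  rw [← integral_finsetSum _ fun y _ => integrable_adoptsA SA SB τ y]
  congr 1
  funext ω
  rw [Finset.card_filter]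
  push_cast
  congr!

lemma card_ties_pos : (0 : ℝ) < Fintype.card (Ties V) := by
  have : Nonempty (Ties V) := ⟨⟨fun _ => (Fintype.equivFin V).symm, fun _ => true⟩⟩
  exact_mod_cast Fintype.card_pos

open Classical in
/-- If for each outcome the indicators of adoption satisfy an inequality, with a gain on an event of
probability at least `δ`, then so do the probabilities of adoption. -/
lemma sigmaAt_add_sigmaAt_add_le {S₁ S₂ S₃ S₄ SB : Finset V} {y : V} {δ : ℝ} {E : Set (Draws V)}
    (hE : MeasurableSet E) (hδ : δ ≤ volume.real E)
    (h : ∀ τ ω, (if AdoptsA N P S₁ SB τ ω y then (1 : ℝ) else 0) +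
        (if AdoptsA N P S₂ SB τ ω y then 1 else 0) + E.indicator 1 ω ≤
      (if AdoptsA N P S₃ SB τ ω y then 1 else 0) +
        (if AdoptsA N P S₄ SB τ ω y then 1 else 0)) :
    sigmaAt N P S₁ SB y + sigmaAt N P S₂ SB y + δ ≤
      sigmaAt N P S₃ SB y + sigmaAt N P S₄ SB y := by
  have hi (S : Finset V) (τ : Ties V) := integrable_adoptsA (N := N) (P := P) S SB τ y
  have hEi : Integrable (E.indicator (1 : Draws V → ℝ)) :=
    (integrable_const (1 : ℝ)).indicator hE
  have hc : (∑ _τ : Ties V, δ) / (Fintype.card (Ties V) : ℝ) = δ := by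
    rw [Finset.sum_const, Finset.card_univ, nsmul_eq_mul]
    exact mul_div_cancel_left₀ _ card_ties_pos.ne'
  rw [← hc]
  simp only [sigmaAt, expectation, ← add_div, ← Finset.sum_add_distrib]
  refine div_le_div_of_nonneg_right (Finset.sum_le_sum fun τ _ => ?_) card_ties_pos.le
  calc _ ≤ (∫ ω, if AdoptsA N P S₁ SB τ ω y then (1 : ℝ) else 0) +
        (∫ ω, if AdoptsA N P S₂ SB τ ω y then (1 : ℝ) else 0) + ∫ ω, E.indicator 1 ω := by
        rw [integral_indicator_one hE]
        gcongr
    _ ≤ _ := by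
        rw [← integral_add (hi _ _) (hi _ _), ← integral_add (hi _ _) (hi _ _)]
        refine (integral_add ((hi S₁ τ).add (hi S₂ τ)) hEi).symm.trans_le ?_
        exact integral_mono (((hi _ _).add (hi _ _)).add hEi) ((hi _ _).add (hi _ _)) (h τ)

lemma sigmaAt_nonneg (SA SB : Finset V) (y : V) : 0 ≤ sigmaAt N P SA SB y := by
  classical
  refine div_nonneg (Finset.sum_nonneg fun τ _ => integral_nonneg fun ω => ?_) card_ties_pos.le
  dsimp only
  split_ifs <;> simp

lemma sigmaAt_le_one (SA SB : Finset V) (y : V) : sigmaAt N P SA SB y ≤ 1 := by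
  classical
  rw [sigmaAt, expectation, div_le_one card_ties_pos]
  calc _ ≤ ∑ _τ : Ties V, (1 : ℝ) := Finset.sum_le_sum fun τ _ => by
        refine (integral_mono (integrable_adoptsA SA SB τ y) (integrable_const 1) fun ω => ?_).trans
          (by simp)
        dsimp only
        split_ifs <;> simp
    _ = _ := by simp

/-- The summand 0 stands for the indicator of the empty event in `sigmaAt_add_sigmaAt_add_le`. -/
lemma ite_add_ite_le_of_iff_or {p q r s : Prop} [Decidable p] [Decidable q] [Decidable r]
    [Decidable s] (hs : s ↔ q ∨ r) (hq : p → q) (hr : p → r) :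
    (if p then (1 : ℝ) else 0) + (if s then 1 else 0) + 0 ≤
      (if q then 1 else 0) + (if r then 1 else 0) := by
  by_cases p <;> by_cases q <;> by_cases r <;> simp_all

/-- Under any of the three conditions, the expected influence is submodular. -/
theorem isSubmodular_sigma (hC : P.Complementary) (hP : P.Balanced)
    (h : P.q0 .A = P.q1 .A ∨ P.q0 .B = P.q1 .B ∨ P.q0 .B = 0) (SB : Finset V) :
    IsSubmodular fun SA => sigma N P SA SB := by
  classical
  intro S a b
  simp only [sigma_eq_sum_sigmaAt, ← Finset.sum_add_distrib]
  refine Finset.sum_le_sum fun y _ => ?_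
  rw [← add_zero (_ + _)]
  refine sigmaAt_add_sigmaAt_add_le MeasurableSet.empty measureReal_nonneg fun τ ω => ?_
  obtain ⟨g, hg⟩ := exists_adoptsA_iff_reach (N := N) hC hP h SB τ ω
  have hab : AdoptsA N P (S ∪ {a, b}) SB τ ω y ↔
      AdoptsA N P (S ∪ {a}) SB τ ω y ∨ AdoptsA N P (S ∪ {b}) SB τ ω y := by
    simp only [hg, reach_union, Finset.insert_eq]
    tauto
  have ha : AdoptsA N P S SB τ ω y → AdoptsA N P (S ∪ {a}) SB τ ω y := by
    simp only [hg]
    exact Reach.mono Finset.subset_union_left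
  have hb : AdoptsA N P S SB τ ω y → AdoptsA N P (S ∪ {b}) SB τ ω y := by
    simp only [hg]
    exact Reach.mono Finset.subset_union_left
  rw [Set.indicator_empty]
  exact ite_add_ite_le_of_iff_or hab ha hb

end Measurability

/-! ### A vertex with one in-neighbour -/

section Receive

variable {P : Params} {θ : Idea → unitInterval} {s : NodeState}

/-- `fresh` is a log that is written but never read, so earlier entries can be split off. -/
lemma receive_mk (st : Idea → Status) (l : List Idea) (X : Idea) :
    receive P θ ⟨st, l⟩ X =
      ⟨(receive P θ ⟨st, []⟩ X).status, l ++ (receive P θ ⟨st, []⟩ X).fresh⟩ := by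
  unfold receive
  dsimp only
  split_ifs <;> simp

lemma foldl_receive_mk (st : Idea → Status) (l l' : List Idea) :
    l'.foldl (receive P θ) ⟨st, l⟩ =
      ⟨(l'.foldl (receive P θ) ⟨st, []⟩).status,
        l ++ (l'.foldl (receive P θ) ⟨st, []⟩).fresh⟩ := by
  induction l' generalizing st l with
  | nil => simp
  | cons X l' ih =>
    rw [List.foldl_cons, List.foldl_cons, receive_mk, ih]
    conv_rhs => rw [show receive P θ ⟨st, []⟩ X = ⟨(receive P θ ⟨st, []⟩ X).status,
      (receive P θ ⟨st, []⟩ X).fresh⟩ from rfl, ih]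
    simp

open Classical in
-- A vertex holding A ignores further proposals of A and settles B for good at its first proposal.
lemma foldl_receive_fresh_of_adopted (l : List Idea) (hA : s.status .A = .adopted) :
    (l.foldl (receive P θ) s).fresh = s.fresh ++
      (if s.status .B = .idle ∧ .B ∈ l ∧ (θ .B : ℝ) < P.q1 .B then [.B] else []) := by
  induction l generalizing s with
  | nil => simp
  | cons X l ih =>
    rw [List.foldl_cons, ih (receive_adopted hA)]
    cases X
    · simp [receive, hA]
    · by_cases hB : s.status .B = .idle
      · by_cases h : (θ .B : ℝ) < P.q1 .B <;> simp [receive, hA, hB, h]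
      · simp [receive, hB]

variable (hA : s.status .A = .idle) (hB : s.status .B = .idle) (hs : s.fresh = [])

include hA hB hs

lemma mem_receive_B_fresh : .B ∈ (receive P θ s .B).fresh ↔ (θ .B : ℝ) < P.q0 .B := by
  by_cases h : (θ .B : ℝ) < P.q0 .B <;> simp [receive, hA, hB, hs, h]

lemma not_mem_receive_A_fresh : .B ∉ (receive P θ s .A).fresh := by
  by_cases h : (θ .A : ℝ) < P.q0 .A <;> simp [receive, hA, hB, hs, h]

/-- When A comes first, its fate decides which threshold B meets; a reconsideration of A afterwards
has no effect on B. -/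
lemma mem_receive_A_B_fresh : .B ∈ (receive P θ (receive P θ s .A) .B).fresh ↔
    if (θ .A : ℝ) < P.q0 .A then (θ .B : ℝ) < P.q1 .B else (θ .B : ℝ) < P.q0 .B := by
  by_cases h : (θ .A : ℝ) < P.q0 .A
  · by_cases h' : (θ .B : ℝ) < P.q1 .B <;> simp [receive, hA, hB, hs, h, h']
  · by_cases h' : (θ .B : ℝ) < P.q0 .B
    · by_cases h'' : (θ .A : ℝ) < P.q0 .A + (1 - P.q0 .A) * P.rho .A <;>
        simp [receive, hA, hB, hs, h, h', h'']
    · simp [receive, hA, hB, hs, h, h']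

omit hs in
lemma receive_A_status : (receive P θ s .A).status .A = .adopted ↔ (θ .A : ℝ) < P.q0 .A := by
  by_cases h : (θ .A : ℝ) < P.q0 .A <;> simp [receive, hA, hB, h]

-- The second alternative is the only way in which B helps A here: A is suspended, B is adopted
-- unaided, and A is reconsidered.
omit hs in
lemma receive_A_B_status : (receive P θ (receive P θ s .A) .B).status .A = .adopted ↔
    (θ .A : ℝ) < P.q0 .A ∨ (θ .B : ℝ) < P.q0 .B ∧ (θ .A : ℝ) < P.reconsider .A := by
  unfold Params.reconsider
  by_cases h : (θ .A : ℝ) < P.q0 .A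
  · simp [h, receive_adopted ((receive_A_status hA hB).2 h)]
  · by_cases h' : (θ .B : ℝ) < P.q0 .B
    · by_cases h'' : (θ .A : ℝ) < P.q0 .A + (1 - P.q0 .A) * P.rho .A <;>
        simp [receive, hA, hB, h, h', h'']
    · simp [receive, hA, hB, h, h']

end Receive

section Cascade

variable {V : Type*} [Fintype V] [DecidableEq V] (N : Network V) (P : Params)
  (SA SB : Finset V) (τ : Ties V) (ω : Draws V)

/-- The ideas that the vertex `y` adopts up to time `k`, in the order of their adoption. -/
def emitted (k : ℕ) (y : V) : List Idea :=
  (List.range (k + 1)).flatMap fun j => (stateAt N P SA SB τ ω j y).fresh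

variable {N P SA SB τ ω}

lemma emitted_zero (y : V) : emitted N P SA SB τ ω 0 y = (initial SA SB τ y).fresh := by
  simp [emitted, stateAt]

lemma emitted_succ (k : ℕ) (y : V) : emitted N P SA SB τ ω (k + 1) y =
    emitted N P SA SB τ ω k y ++ (stateAt N P SA SB τ ω (k + 1) y).fresh := by
  simp [emitted, List.range_succ]

lemma proposals_eq_of_live_iff {x y : V} (h : ∀ z, Live N ω z y ↔ z = x) (s : V → NodeState) :
    proposals N τ ω s y = (s x).fresh := by
  classical
  have hl : (List.ofFn (τ.1 y)).filter (fun z => decide (Live N ω z y)) = [x] := by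
    simp only [h]
    have hnd : (List.ofFn (τ.1 y)).Nodup := List.nodup_ofFn.2 (τ.1 y).injective
    have hx : x ∈ List.ofFn (τ.1 y) := by
      rw [List.mem_ofFn]
      exact (τ.1 y).surjective x
    have := List.filter_eq (l := List.ofFn (τ.1 y)) x
    rw [List.count_eq_one_of_mem hnd hx] at this
    rw [← List.replicate_one, ← this]
  rw [proposals]
  exact (congrArg _ hl).trans (by simp)

omit [DecidableEq V] in
lemma proposals_eq_nil_of_not_live {y : V} (h : ∀ z, ¬ Live N ω z y) (s : V → NodeState) :
    proposals N τ ω s y = [] := by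
  refine List.eq_nil_iff_forall_not_mem.2 fun X hX => ?_
  obtain ⟨x, hx, -⟩ := mem_proposals.1 hX
  exact h x hx

/-- The state of a vertex with one in-neighbour results from the ideas emitted by the latter,
irrespective of the times at which they are proposed. -/
lemma stateAt_of_live_iff {x y : V} (h : ∀ z, Live N ω z y ↔ z = x) (k : ℕ) :
    ((emitted N P SA SB τ ω k x).foldl (receive P (ω.2 y)) (initial SA SB τ y)) =
      ⟨(stateAt N P SA SB τ ω (k + 1) y).status, emitted N P SA SB τ ω (k + 1) y⟩ := by
  have hstep (k : ℕ) : stateAt N P SA SB τ ω (k + 1) y =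
      (stateAt N P SA SB τ ω k x).fresh.foldl (receive P (ω.2 y))
        ⟨(stateAt N P SA SB τ ω k y).status, []⟩ := by
    rw [stateAt_succ, step, proposals_eq_of_live_iff h]
  induction k with
  | zero =>
    rw [emitted_succ, hstep, emitted_zero, emitted_zero]
    exact foldl_receive_mk _ _ _
  | succ k ih =>
    rw [emitted_succ, List.foldl_append, ih, emitted_succ (k + 1), hstep (k + 1)]
    exact foldl_receive_mk _ _ _

/-! ### Paths -/

/-- The vertices `e 0, …, e (n - 1)` form a directed path with probability `1` on each edge, and no
other edges lead to them. -/
structure IsPath {n : ℕ} (N : Network V) (e : Fin n ↪ V) : Prop where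
  adj_iff : ∀ x j, N.graph.Adj x (e j) ↔ ∃ i : Fin n, (i : ℕ) + 1 = j ∧ x = e i
  prob_eq : ∀ x y, N.p x y = 1

variable {n : ℕ} {e : Fin n ↪ V}

omit [Fintype V] [DecidableEq V] in
lemma IsPath.live_iff (h : IsPath N e) {i j : Fin n} (hij : (i : ℕ) + 1 = j) (z : V) :
    Live N ω z (e j) ↔ z = e i := by
  rw [Live, h.prob_eq, h.adj_iff]
  constructor
  · rintro ⟨⟨i', hi', rfl⟩, -⟩
    congr
    omega
  · rintro rfl
    exact ⟨⟨i, hij, rfl⟩, unitInterval.le_one'⟩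

/-- Ideas move one edge per step, so everything that starts on the path has passed vertex `i` by
time `i`. -/
lemma IsPath.fresh_eq_nil (h : IsPath N e) (i : Fin n) {k : ℕ} (hk : (i : ℕ) < k) :
    (stateAt N P SA SB τ ω k (e i)).fresh = [] := by
  obtain ⟨i, hi⟩ := i
  obtain ⟨k, rfl⟩ := Nat.exists_eq_add_one.2 (Nat.zero_lt_of_lt hk)
  induction i generalizing k with
  | zero =>
    rw [stateAt_succ, step, proposals_eq_nil_of_not_live]
    · rfl
    · rintro z ⟨hz, -⟩
      obtain ⟨i, hi, -⟩ := (h.adj_iff _ _).1 hz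
      simp at hi
  | succ i ih =>
    obtain ⟨k, rfl⟩ := Nat.exists_eq_add_one.2 (show 0 < k by dsimp at hk; omega)
    rw [stateAt_succ, step,
      proposals_eq_of_live_iff (h.live_iff (i := ⟨i, by omega⟩) (j := ⟨i + 1, hi⟩) rfl),
      ih (by omega) _ (by dsimp at hk ⊢; omega)]
    rfl

lemma IsPath.emitted_eq (h : IsPath N e) (i : Fin n) {k : ℕ} (hk : (i : ℕ) ≤ k) :
    emitted N P SA SB τ ω k (e i) = emitted N P SA SB τ ω i (e i) := by
  induction k, hk using Nat.le_induction with
  | base => rfl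
  | succ k hk ih => rw [emitted_succ, ih, h.fresh_eq_nil i (by omega), List.append_nil]

lemma IsPath.emitted_succ_eq (h : IsPath N e) {i j : Fin n} (hij : (i : ℕ) + 1 = j) :
    emitted N P SA SB τ ω j (e j) =
      ((emitted N P SA SB τ ω i (e i)).foldl (receive P (ω.2 (e j)))
        (initial SA SB τ (e j))).fresh := by
  rw [stateAt_of_live_iff (h.live_iff hij), hij]

lemma IsPath.adoptsA_iff (h : IsPath N e) {i j : Fin n} (hij : (i : ℕ) + 1 = j) :
    AdoptsA N P SA SB τ ω (e j) ↔
      ((emitted N P SA SB τ ω i (e i)).foldl (receive P (ω.2 (e j)))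
        (initial SA SB τ (e j))).status .A = .adopted := by
  constructor
  · rintro ⟨k, hk⟩
    have := adopted_mono (show k ≤ max k i + 1 by omega) hk
    rwa [← h.emitted_eq i (le_max_right k i), stateAt_of_live_iff (h.live_iff hij)]
  · rw [stateAt_of_live_iff (h.live_iff hij)]
    exact fun hk => ⟨_, hk⟩

end Cascade

/-! ### The counterexample -/

/-- The seeds of `A` on the path with six vertices: the vertices `2` and `4`, and optionally
`1` and `3`. -/
def pathSeeds (a b : Bool) : Finset (Fin 6) :=
  {2, 4} ∪ (if a then {1} else ∅) ∪ (if b then {3} else ∅)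

/-- The event that witnesses the failure of submodularity requires the threshold of vertex `i` for
the idea `X` to be at least `lowerBound P i X`. -/
def lowerBound (P : Params) : Fin 6 → Idea → ℝ
  | 1, .B => P.q0 .B
  | 3, .A => P.q0 .A
  | 3, .B => P.q0 .B
  | 5, .A => P.q0 .A
  | _, _ => 0

/-- The event that witnesses the failure of submodularity requires the threshold of vertex `i` for
the idea `X` to be less than `upperBound P i X`. -/
def upperBound (P : Params) : Fin 6 → Idea → ℝ
  | 1, .B => P.q1 .B
  | 2, .B => P.q1 .B
  | 3, .B => P.q1 .B
  | 4, .B => P.q1 .B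
  | 5, .A => P.reconsider .A
  | 5, .B => P.q0 .B
  -- Thresholds lie in [0, 1], so the default bounds 0 and 2 impose nothing.
  | _, _ => 2

section Cascade

variable {V : Type*} [Fintype V] [DecidableEq V] {N : Network V} {P : Params}
  {SA SB : Finset V} {τ : Ties V} {ω : Draws V} {e : Fin 6 ↪ V}

/-- A seed of A emits A at time 0, ahead of any B, whatever happens upstream. This is the purpose of
the permanent seeds 2 and 4: downstream of them only the passage of B carries information. -/
lemma emitted_of_seed {n : ℕ} {e : Fin n ↪ V} (h : IsPath N e) {i j : Fin n}
    (hij : (i : ℕ) + 1 = j) (hA : e j ∈ SA) (hB : e j ∉ SB) :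
    (.B ∈ emitted N P SA SB τ ω i (e i) ∧ (ω.2 (e j) .B : ℝ) < P.q1 .B) ∧
        emitted N P SA SB τ ω j (e j) = [.A, .B] ∨
      ¬ (.B ∈ emitted N P SA SB τ ω i (e i) ∧ (ω.2 (e j) .B : ℝ) < P.q1 .B) ∧
        emitted N P SA SB τ ω j (e j) = [.A] := by
  rw [h.emitted_succ_eq hij, foldl_receive_fresh_of_adopted _ (by simp [initial, hA])]
  by_cases hc : .B ∈ emitted N P SA SB τ ω i (e i) ∧ (ω.2 (e j) .B : ℝ) < P.q1 .B
  · exact .inl ⟨hc, by simp [initial, hA, hB, hc]⟩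
  · exact .inr ⟨hc, by simp [initial, hA, hB, hc]⟩

lemma mem_emitted_of_seed {n : ℕ} {e : Fin n ↪ V} (h : IsPath N e) {i j : Fin n}
    (hij : (i : ℕ) + 1 = j) (hA : e j ∈ SA) (hB : e j ∉ SB) :
    .B ∈ emitted N P SA SB τ ω j (e j) ↔
      .B ∈ emitted N P SA SB τ ω i (e i) ∧ (ω.2 (e j) .B : ℝ) < P.q1 .B := by
  rcases emitted_of_seed (P := P) (τ := τ) (ω := ω) h hij hA hB with ⟨hc, he⟩ | ⟨hc, he⟩ <;>
    simp [he, hc]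

/-- Vertex 3, if not a seed, hears A from 2 before any B, and vertex 5 hears A from 4 before any B,
in all four seed configurations. So `a` enters only through the threshold for B at 1, and `b` only
through the one at 3. -/
lemma adoptsA_iff_of_isPath (h : IsPath N e) {a b : Bool}
    (hSA : ∀ i, e i ∈ SA ↔ i ∈ pathSeeds a b) (hSB : ∀ i, e i ∈ SB ↔ i = 0) :
    AdoptsA N P SA SB τ ω (e 5) ↔
      (ω.2 (e 5) .A : ℝ) < P.q0 .A ∨
      ((if a then (ω.2 (e 1) .B : ℝ) < P.q1 .B else (ω.2 (e 1) .B : ℝ) < P.q0 .B) ∧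
        (ω.2 (e 2) .B : ℝ) < P.q1 .B ∧
        (if b then (ω.2 (e 3) .B : ℝ) < P.q1 .B else
          if (ω.2 (e 3) .A : ℝ) < P.q0 .A then (ω.2 (e 3) .B : ℝ) < P.q1 .B
          else (ω.2 (e 3) .B : ℝ) < P.q0 .B) ∧
        (ω.2 (e 4) .B : ℝ) < P.q1 .B) ∧
      (ω.2 (e 5) .B : ℝ) < P.q0 .B ∧ (ω.2 (e 5) .A : ℝ) < P.reconsider .A := by
  have hB (i : Fin 6) (hi : i ≠ 0) : e i ∉ SB := by rwa [hSB]
  have hA2 : e 2 ∈ SA := by rw [hSA]; cases a <;> cases b <;> decide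
  have hA4 : e 4 ∈ SA := by rw [hSA]; cases a <;> cases b <;> decide
  have hA5 : e 5 ∉ SA := by rw [hSA]; cases a <;> cases b <;> decide
  have hA0 : e 0 ∉ SA := by rw [hSA]; cases a <;> cases b <;> decide
  have hidle (i : Fin 6) (hi : i ≠ 0) (hA : e i ∉ SA) :
      (initial SA SB τ (e i)).status .A = .idle ∧ (initial SA SB τ (e i)).status .B = .idle ∧
        (initial SA SB τ (e i)).fresh = [] := by
    simp [initial, hB i hi, hA]
  have h0 : emitted N P SA SB τ ω (0 : Fin 6) (e 0) = [.B] := by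
    rw [Fin.val_zero, emitted_zero]
    simp [initial, hA0, (hSB 0).2 rfl]
  have h1 : .B ∈ emitted N P SA SB τ ω (1 : Fin 6) (e 1) ↔
      if a then (ω.2 (e 1) .B : ℝ) < P.q1 .B else (ω.2 (e 1) .B : ℝ) < P.q0 .B := by
    cases a
    · obtain ⟨hA, hB, hf⟩ := hidle 1 (by decide) (by rw [hSA]; cases b <;> decide)
      rw [h.emitted_succ_eq (i := 0) (j := 1) rfl, h0]
      simpa using mem_receive_B_fresh hA hB hf
    · rw [mem_emitted_of_seed h (i := 0) (j := 1) rfl (by rw [hSA]; cases b <;> decide)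
        (hB 1 (by decide)), h0]
      simp
  have h2 := mem_emitted_of_seed (P := P) (τ := τ) (ω := ω) h (i := 1) (j := 2) rfl hA2
    (hB 2 (by decide))
  have h3 : .B ∈ emitted N P SA SB τ ω (3 : Fin 6) (e 3) ↔
      .B ∈ emitted N P SA SB τ ω (2 : Fin 6) (e 2) ∧
        if b then (ω.2 (e 3) .B : ℝ) < P.q1 .B else
          if (ω.2 (e 3) .A : ℝ) < P.q0 .A then (ω.2 (e 3) .B : ℝ) < P.q1 .B
          else (ω.2 (e 3) .B : ℝ) < P.q0 .B := by
    cases b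
    · obtain ⟨hA, hB3, hf⟩ := hidle 3 (by decide) (by rw [hSA]; cases a <;> decide)
      rw [h.emitted_succ_eq (i := 2) (j := 3) rfl]
      rcases emitted_of_seed (P := P) (τ := τ) (ω := ω) h (i := 1) (j := 2) rfl hA2
        (hB 2 (by decide)) with ⟨-, he⟩ | ⟨-, he⟩
      · rw [he, List.foldl_cons, List.foldl_cons, List.foldl_nil, mem_receive_A_B_fresh hA hB3 hf]
        simp
      · rw [he, List.foldl_cons, List.foldl_nil]
        simpa using not_mem_receive_A_fresh hA hB3 hf
    · rw [mem_emitted_of_seed h (i := 2) (j := 3) rfl (by rw [hSA]; cases a <;> decide)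
        (hB 3 (by decide))]
      simp
  obtain ⟨hA, hB5, -⟩ := hidle 5 (by decide) hA5
  have h4 := emitted_of_seed (P := P) (τ := τ) (ω := ω) h (i := 3) (j := 4) rfl hA4
    (hB 4 (by decide))
  rw [h3, h2, h1] at h4
  rw [h.adoptsA_iff (i := 4) (j := 5) rfl]
  rcases h4 with ⟨hc, he⟩ | ⟨hc, he⟩
  · rw [he, List.foldl_cons, List.foldl_cons, List.foldl_nil, receive_A_B_status hA hB5]
    obtain ⟨⟨⟨hc1, hc2⟩, hc3⟩, hc4⟩ := hc
    exact or_congr_right ⟨fun h => ⟨⟨hc1, hc2, hc3, hc4⟩, h⟩, And.right⟩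
  · rw [he, List.foldl_cons, List.foldl_nil, receive_A_status hA hB5]
    refine ⟨.inl, fun h => h.resolve_right ?_⟩
    rintro ⟨⟨hc1, hc2, hc3, hc4⟩, -⟩
    exact hc ⟨⟨⟨hc1, hc2⟩, hc3⟩, hc4⟩

/-- The event that witnesses the failure of submodularity. -/
def violation (P : Params) (e : Fin 6 → V) : Set (Draws V) :=
  {ω | ∀ i X, lowerBound P i X ≤ ω.2 (e i) X ∧ (ω.2 (e i) X : ℝ) < upperBound P i X}

/-- The probability of the event that witnesses the failure of submodularity. -/
def gap (P : Params) : ℝ :=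
  ∏ i : Fin 6, ∏ X : Idea,
    volume.real {x : unitInterval | lowerBound P i X ≤ x ∧ (x : ℝ) < upperBound P i X}

omit [Fintype V] [DecidableEq V] in
lemma measurableSet_violation (P : Params) (e : Fin 6 → V) : MeasurableSet (violation P e) := by
  have h (i : Fin 6) (X : Idea) : Measurable fun ω : Draws V => (ω.2 (e i) X : ℝ) := by fun_prop
  simp only [violation, Set.ofPred_forall]
  exact .iInter fun i => .iInter fun X =>
    (measurableSet_le measurable_const (h i X)).inter (measurableSet_lt (h i X) measurable_const)

-- The event constrains independent coordinates separately, and vertices off the path contribute the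
-- factor 1. The value depends on neither the network nor `e`, so one bound serves all duplicates.
omit [DecidableEq V] in
lemma volume_violation (P : Params) (e : Fin 6 ↪ V) : volume.real (violation P e) = gap P := by
  let J (i : Fin 6) (X : Idea) : Set unitInterval :=
    {x | lowerBound P i X ≤ x ∧ (x : ℝ) < upperBound P i X}
  let K (v : V) (X : Idea) : Set unitInterval := {x | ∀ i, e i = v → x ∈ J i X}
  have hK (i : Fin 6) (X : Idea) : K (e i) X = J i X := by
    ext x
    refine ⟨fun h => h i rfl, fun h j hj => ?_⟩
    rwa [e.injective hj]
  have hE : violation P e = Set.univ ×ˢ Set.univ.pi fun v => Set.univ.pi (K v) := by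
    ext ω
    simp only [violation, Set.mem_ofPred_eq, Set.mem_prod, Set.mem_univ, true_and, Set.mem_pi,
      true_imp_iff]
    constructor
    · rintro h _ X i rfl
      exact h i X
    · exact fun h i X => h (e i) X i rfl
  rw [hE, Measure.real, Measure.volume_eq_prod, Measure.prod_prod, measure_univ, one_mul,
    volume_pi_pi, ENNReal.toReal_prod]
  symm
  refine Fintype.prod_of_injective e e.injective _ _ (fun v hv => ?_) (fun i => ?_)
  · have hv' : K v = fun _ => Set.univ := by
      funext X
      exact Set.eq_univ_of_forall fun x i hi => (hv ⟨i, hi⟩).elim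
    simp [hv']
  · rw [volume_pi_pi, ENNReal.toReal_prod]
    simp only [hK]
    rfl

lemma volume_real_pos {a b : ℝ} (hab : a < b) (ha : a < 1) (hb : 0 < b) :
    0 < volume.real {x : unitInterval | a ≤ x ∧ (x : ℝ) < b} := by
  have h0 : (0 : ℝ) ≤ max a 0 := le_max_right _ _
  have h1 : min b 1 ≤ (1 : ℝ) := min_le_right _ _
  have hlt : max a 0 < min b 1 := max_lt (lt_min hab ha) (lt_min hb one_pos)
  let x : unitInterval := ⟨max a 0, h0, hlt.le.trans h1⟩
  let y : unitInterval := ⟨min b 1, h0.trans hlt.le, h1⟩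
  have hsub : Set.Ico x y ⊆ {x : unitInterval | a ≤ x ∧ (x : ℝ) < b} := fun z hz =>
    ⟨(le_max_left a 0).trans (Subtype.coe_le_coe.2 hz.1),
      (Subtype.coe_lt_coe.2 hz.2).trans_le (min_le_left b 1)⟩
  refine lt_of_lt_of_le ?_ (measureReal_mono hsub)
  rw [Measure.real, unitInterval.volume_Ico, ENNReal.toReal_ofReal (sub_nonneg.2 hlt.le)]
  exact sub_pos.2 hlt

/-- Each interval is nonempty: q_{B|∅} < q_{B|A} serves B at 1 and 3, q_{A|∅} < q_{A|B} (the
reconsideration threshold, by balance) serves A at 5, and q_{B|∅} > 0 serves B at 5. The rest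
follows, such as q_{A|∅} < 1 for A at 3. -/
lemma gap_pos (hP : P.AreProbabilities) (hC : P.Complementary) (hb : P.Balanced)
    (h : ¬ (P.q0 .A = P.q1 .A ∨ P.q0 .B = P.q1 .B ∨ P.q0 .B = 0)) : 0 < gap P := by
  push Not at h
  obtain ⟨hA, hB, hB0⟩ := h
  have hrA : P.reconsider .A = P.q1 .A := by
    have := hb .A
    refine mul_left_cancel₀ hB0 ?_
    simp only [Params.reconsider, Idea.other_A] at *
    linarith
  obtain ⟨⟨hA1, hA2⟩, ⟨hA3, hA4⟩, -⟩ := hP .A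
  obtain ⟨⟨hB1, hB2⟩, ⟨hB3, hB4⟩, -⟩ := hP .B
  have hA' := lt_of_le_of_ne (hC .A) hA
  have hB' := lt_of_le_of_ne (hC .B) hB
  have hB0' := lt_of_le_of_ne hB1 hB0.symm
  refine Finset.prod_pos fun i _ => Finset.prod_pos fun X _ => volume_real_pos ?_ ?_ ?_ <;>
    fin_cases i <;> cases X <;> simp [lowerBound, upperBound, hrA] <;> linarith

/-- Supermodularity of conjunction, with a gain where both switches matter and `p` does not already
decide. -/
lemma ite_add_ite_add_ite_le {p q u u' v v' : Prop} [Decidable p] [Decidable q] [Decidable u]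
    [Decidable u'] [Decidable v] [Decidable v'] (hu : u → u') (hv : v → v') :
    (if p ∨ u' ∧ v ∧ q then (1 : ℝ) else 0) + (if p ∨ u ∧ v' ∧ q then 1 else 0) +
        (if ¬ p ∧ q ∧ u' ∧ ¬ u ∧ v' ∧ ¬ v then 1 else 0) ≤
      (if p ∨ u ∧ v ∧ q then 1 else 0) + (if p ∨ u' ∧ v' ∧ q then 1 else 0) := by
  by_cases p <;> by_cases q <;> by_cases u <;> by_cases u' <;> by_cases v <;> by_cases v' <;>
    simp_all

/-- The probability that the last vertex of the path adopts `A` is not submodular. -/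
lemma sigmaAt_add_sigmaAt_add_gap_le (hC : P.Complementary) (h : IsPath N e)
    {S : Bool → Bool → Finset V} (hS : ∀ a b i, e i ∈ S a b ↔ i ∈ pathSeeds a b)
    (hSB : ∀ i, e i ∈ SB ↔ i = 0) :
    sigmaAt N P (S true false) SB (e 5) + sigmaAt N P (S false true) SB (e 5) + gap P ≤
      sigmaAt N P (S false false) SB (e 5) + sigmaAt N P (S true true) SB (e 5) := by
  classical
  refine sigmaAt_add_sigmaAt_add_le (measurableSet_violation P e) (volume_violation P e).ge
    fun τ ω => ?_
  have key (a b : Bool) := adoptsA_iff_of_isPath (P := P) (τ := τ) (ω := ω) h (hS a b) hSB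
  let p : Prop := (ω.2 (e 5) .A : ℝ) < P.q0 .A
  let q : Prop := (ω.2 (e 2) .B : ℝ) < P.q1 .B ∧ (ω.2 (e 4) .B : ℝ) < P.q1 .B ∧
    (ω.2 (e 5) .B : ℝ) < P.q0 .B ∧ (ω.2 (e 5) .A : ℝ) < P.reconsider .A
  let u (a : Bool) : Prop :=
    if a then (ω.2 (e 1) .B : ℝ) < P.q1 .B else (ω.2 (e 1) .B : ℝ) < P.q0 .B
  let v (b : Bool) : Prop :=
    if b then (ω.2 (e 3) .B : ℝ) < P.q1 .B else
      if (ω.2 (e 3) .A : ℝ) < P.q0 .A then (ω.2 (e 3) .B : ℝ) < P.q1 .B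
      else (ω.2 (e 3) .B : ℝ) < P.q0 .B
  have key (a b : Bool) : AdoptsA N P (S a b) SB τ ω (e 5) ↔ p ∨ u a ∧ v b ∧ q := by
    rw [adoptsA_iff_of_isPath h (hS a b) hSB]
    change p ∨ (u a ∧ _ ∧ v b ∧ _) ∧ _ ∧ _ ↔ _
    simp only [q]
    tauto
  have hu : u false → u true := fun h => lt_of_lt_of_le h (hC .B)
  have hv : v false → v true := by
    intro h
    by_cases hA : (ω.2 (e 3) .A : ℝ) < P.q0 .A
    · simpa [v, hA] using h
    · have : (ω.2 (e 3) .B : ℝ) < P.q0 .B := by simpa [v, hA] using h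
      exact lt_of_lt_of_le this (hC .B)
  have hE : (violation P e).indicator 1 ω ≤
      (if ¬ p ∧ q ∧ u true ∧ ¬ u false ∧ v true ∧ ¬ v false then (1 : ℝ) else 0) := by
    by_cases hω : ω ∈ violation P e
    · rw [Set.indicator_of_mem hω, if_pos]
      · rfl
      have h3 : ¬ (ω.2 (e 3) .A : ℝ) < P.q0 .A := not_lt.2 (hω 3 .A).1
      refine ⟨not_lt.2 (hω 5 .A).1, ⟨(hω 2 .B).2, (hω 4 .B).2, (hω 5 .B).2, (hω 5 .A).2⟩,
        (hω 1 .B).2, not_lt.2 (hω 1 .B).1, (hω 3 .B).2, ?_⟩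
      have h3' : ¬ (ω.2 (e 3) .B : ℝ) < P.q0 .B := not_lt.2 (hω 3 .B).1
      simpa [v, h3] using h3'
    · rw [Set.indicator_of_notMem hω]
      split_ifs <;> simp
  refine le_trans (add_le_add le_rfl hE) ?_
  rw [if_congr (key true false) rfl rfl, if_congr (key false true) rfl rfl,
    if_congr (key false false) rfl rfl, if_congr (key true true) rfl rfl]
  exact ite_add_ite_add_ite_le hu hv

end Cascade

/-! ### The path itself and the path with duplicated end -/

lemma isPath_pathNetwork (n : ℕ) : IsPath (pathNetwork n) (Function.Embedding.refl (Fin n)) where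
  adj_iff x j := by simp [pathNetwork]
  prob_eq _ _ := rfl

/-- The path in the network with `m` duplicates of the last vertex of the path that leads to the
vertex `y`, which is the last vertex or one of its duplicates. -/
def duplicatePath {m : ℕ} (y : Fin 6 ⊕ Fin m) (hy : Sum.elim id (fun _ => 5) y = (5 : Fin 6)) :
    Fin 6 ↪ Fin 6 ⊕ Fin m where
  toFun i := if i = 5 then y else .inl i
  inj' i j h := by
    -- Folding all duplicates back onto 5 is a left inverse.
    have hproj (i : Fin 6) : Sum.elim id (fun _ => 5) (if i = 5 then y else .inl i) = i := by
      split_ifs with hi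
      · rw [hy, hi]
      · rfl
    rw [← hproj i, ← hproj j]
    exact congrArg _ h

variable {m : ℕ} {y : Fin 6 ⊕ Fin m} (hy : Sum.elim id (fun _ => 5) y = (5 : Fin 6))

lemma duplicatePath_five : duplicatePath y hy 5 = y := rfl

lemma duplicatePath_of_ne {i : Fin 6} (hi : i ≠ 5) : duplicatePath y hy i = .inl i :=
  if_neg hi

lemma sumElim_duplicatePath (i : Fin 6) :
    Sum.elim id (fun _ => 5) (duplicatePath y hy i) = i := by
  by_cases hi : i = 5
  · rw [hi, duplicatePath_five, hy]
  · rw [duplicatePath_of_ne hy hi]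
    rfl

/-- Vertex 5 has no out-edges, hence neither do its duplicates, so exchanging 5 for any one of them
gives another path without foreign in-edges. -/
lemma isPath_duplicate : IsPath ((pathNetwork 6).duplicate 5 m) (duplicatePath y hy) where
  adj_iff x j := by
    simp only [Network.duplicate, sumElim_duplicatePath, pathNetwork]
    constructor
    · intro h
      rcases x with i | k
      · have hi : i ≠ 5 := by
          rintro rfl
          have := j.isLt
          simp at h
          omega
        exact ⟨i, h, (duplicatePath_of_ne hy hi).symm⟩
      · have := j.isLt
        simp at h
        omega
    · rintro ⟨i, hi, rfl⟩
      rwa [sumElim_duplicatePath]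
  prob_eq _ _ := rfl

lemma duplicatePath_mem_map {S : Finset (Fin 6)} (hS : 5 ∉ S) (i : Fin 6) :
    duplicatePath y hy i ∈ S.map (.inl : Fin 6 ↪ Fin 6 ⊕ Fin m) ↔ i ∈ S := by
  by_cases hi : i = 5
  · subst hi
    simp only [hS, iff_false, Finset.mem_map, not_exists, not_and, duplicatePath_five]
    rintro x hx rfl
    have : x = 5 := hy
    exact hS (this ▸ hx)
  · rw [duplicatePath_of_ne hy hi]
    simp

include hy in
lemma sigmaAt_duplicate_add_gap_le {P : Params} (hC : P.Complementary) :
    sigmaAt ((pathNetwork 6).duplicate 5 m) P ((pathSeeds true false).map .inl)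
          (Finset.map .inl {0}) y +
        sigmaAt ((pathNetwork 6).duplicate 5 m) P ((pathSeeds false true).map .inl)
          (Finset.map .inl {0}) y + gap P ≤
      sigmaAt ((pathNetwork 6).duplicate 5 m) P ((pathSeeds false false).map .inl)
          (Finset.map .inl {0}) y +
        sigmaAt ((pathNetwork 6).duplicate 5 m) P ((pathSeeds true true).map .inl)
          (Finset.map .inl {0}) y :=
  sigmaAt_add_sigmaAt_add_gap_le hC (isPath_duplicate hy)
    (S := fun a b => (pathSeeds a b).map .inl)
    (fun a b => duplicatePath_mem_map hy (by cases a <;> cases b <;> decide))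
    (fun i => (duplicatePath_mem_map hy (by decide) i).trans Finset.mem_singleton)

/-- Each of the `m` duplicates gains at least `gap P`. The six original vertices can lose at most 2
each, whence the 12. -/
lemma sigma_duplicate_lt {P : Params} (hC : P.Complementary) (hm : 12 < m * gap P) :
    sigma ((pathNetwork 6).duplicate 5 m) P ((pathSeeds true false).map .inl)
          (Finset.map .inl {0}) +
        sigma ((pathNetwork 6).duplicate 5 m) P ((pathSeeds false true).map .inl)
          (Finset.map .inl {0}) <
      sigma ((pathNetwork 6).duplicate 5 m) P ((pathSeeds false false).map .inl)
          (Finset.map .inl {0}) +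
        sigma ((pathNetwork 6).duplicate 5 m) P ((pathSeeds true true).map .inl)
          (Finset.map .inl {0}) := by
  simp only [sigma_eq_sum_sigmaAt, ← Finset.sum_add_distrib]
  rw [Fintype.sum_sum_type, Fintype.sum_sum_type]
  have h1 := Finset.sum_le_sum fun (k : Fin m) (_ : k ∈ Finset.univ) =>
    sigmaAt_duplicate_add_gap_le (P := P) (y := .inr k) (rfl : _ = (5 : Fin 6)) hC
  have h2 := Finset.sum_le_card_nsmul Finset.univ (fun x : Fin 6 =>
    sigmaAt ((pathNetwork 6).duplicate 5 m) P ((pathSeeds true false).map .inl)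
          (Finset.map .inl {0}) (.inl x) +
        sigmaAt ((pathNetwork 6).duplicate 5 m) P ((pathSeeds false true).map .inl)
          (Finset.map .inl {0}) (.inl x)) 2 fun x _ =>
      (add_le_add (sigmaAt_le_one _ _ _) (sigmaAt_le_one _ _ _)).trans (by norm_num)
  have h3 := Finset.sum_nonneg fun (x : Fin 6) (_ : x ∈ Finset.univ) =>
    add_nonneg
      (sigmaAt_nonneg (N := (pathNetwork 6).duplicate 5 m) (P := P)
        ((pathSeeds false false).map .inl) (Finset.map .inl {0}) (.inl x))
      (sigmaAt_nonneg (N := (pathNetwork 6).duplicate 5 m) (P := P)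
        ((pathSeeds true true).map .inl) (Finset.map .inl {0}) (.inl x))
  rw [Finset.sum_add_distrib (f := fun k : Fin m => _ + _), Finset.sum_const, Finset.card_univ,
    Fintype.card_fin, nsmul_eq_mul] at h1
  rw [Finset.card_univ, Fintype.card_fin, nsmul_eq_mul, Nat.cast_ofNat] at h2
  linarith

end ComIC

end

theorem theorem3 :
    -- whenever one of the three conditions holds, submodularity holds on every network
    (∀ P : ComIC.Params, P.AreProbabilities → P.Complementary → P.Balanced →
      (P.q0 .A = P.q1 .A ∨ P.q0 .B = P.q1 .B ∨ P.q0 .B = 0) →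
      ∀ (V : Type*) [Fintype V] [DecidableEq V] (N : ComIC.Network V) (SB : Finset V),
        IsSubmodular fun SA : Finset V => ComIC.sigma N P SA SB) ∧
    -- one directed path violates submodularity for all other parameters
    (∃ (n : ℕ) (SA SB : Finset (Fin n)) (u v t : Fin n),
      t ∉ SA ∪ SB ∪ {u, v} ∧
      ∀ P : ComIC.Params, P.AreProbabilities → P.Complementary → P.Balanced →
        ¬ (P.q0 .A = P.q1 .A ∨ P.q0 .B = P.q1 .B ∨ P.q0 .B = 0) →
        -- the probability that `t` adopts `A`
        ComIC.sigmaAt (ComIC.pathNetwork n) P (SA ∪ {u}) SB t +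
            ComIC.sigmaAt (ComIC.pathNetwork n) P (SA ∪ {v}) SB t <
          ComIC.sigmaAt (ComIC.pathNetwork n) P SA SB t +
            ComIC.sigmaAt (ComIC.pathNetwork n) P (SA ∪ {u, v}) SB t ∧
        -- the expected influence, once `t` has been duplicated sufficiently often
        ∃ m₀ : ℕ, ∀ m ≥ m₀,
          ComIC.sigma ((ComIC.pathNetwork n).duplicate t m) P
                ((SA ∪ {u}).map .inl) (SB.map .inl) +
              ComIC.sigma ((ComIC.pathNetwork n).duplicate t m) P
                ((SA ∪ {v}).map .inl) (SB.map .inl) <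
            ComIC.sigma ((ComIC.pathNetwork n).duplicate t m) P
                (SA.map .inl) (SB.map .inl) +
              ComIC.sigma ((ComIC.pathNetwork n).duplicate t m) P
                ((SA ∪ {u, v}).map .inl) (SB.map .inl)) := by
  refine ⟨fun P _ hC hb h V _ _ N SB => ComIC.isSubmodular_sigma hC hb h SB,
    6, {2, 4}, {0}, 1, 3, 5, by decide, fun P hP hC hb h => ?_⟩
  have e00 : ({2, 4} : Finset (Fin 6)) = ComIC.pathSeeds false false := by decide
  have e10 : ({2, 4} ∪ {1} : Finset (Fin 6)) = ComIC.pathSeeds true false := by decide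
  have e01 : ({2, 4} ∪ {3} : Finset (Fin 6)) = ComIC.pathSeeds false true := by decide
  have e11 : ({2, 4} ∪ {1, 3} : Finset (Fin 6)) = ComIC.pathSeeds true true := by decide
  rw [e10, e01, e11, e00]
  have hgap := ComIC.gap_pos hP hC hb h
  constructor
  · have := ComIC.sigmaAt_add_sigmaAt_add_gap_le (P := P) hC (ComIC.isPath_pathNetwork 6)
      (S := ComIC.pathSeeds) (SB := {0}) (fun _ _ _ => Iff.rfl) (fun _ => Finset.mem_singleton)
    exact (lt_add_of_pos_right _ hgap).trans_le this
  · obtain ⟨m₀, hm₀⟩ := exists_nat_gt (12 / ComIC.gap P)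
    refine ⟨m₀, fun m hm => ComIC.sigma_duplicate_lt hC ?_⟩
    rw [← div_lt_iff₀ hgap]
    exact hm₀.trans_le (by exact_mod_cast hm)
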